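/- Let $n\ge 1$ and $s>1/2$. Let $f\in C^1((0,\infty))$ be real-valued and assume that $f'$ has only finitely many zeros in $(0,\infty)$. Let $a(\xi)=f(|\xi|)$ for $\xi\in\mathbb R^n\setminus\{0\}$ (the value $a(0)$ is an arbitrary real number), and write $\langle x\rangle=(1+|x|^2)^{1/2}$. For a function $m$ on $\mathbb R^n$ let $m(D_x)$, $D_x=-i\nabla$, denote the Fourier multiplier with symbol $m(\xi)$ on its natural domain $\{\varphi\in L^2(\mathbb R^n): m\widehat\varphi\in L^2(\mathbb R^n)\}$, where $\widehat\varphi(\xi)=\int e^{-ix\cdot\xi}\varphi(x)\,dx$. Then the domain of $|\nabla a(D_x)|^{1/2}$ is dense in $L^2(\mathbb R^n)$, and there is a constant $C>0$ such that $$\bigl\|\langle x\rangle^{-s}\,|\nabla a(D_x)|^{1/2}e^{ita(D_x)}\varphi\bigr\|_{L^2(\mathbb R_t\times\mathbb R^n_x)}\le C\,\|\varphi\|_{L^2(\mathbb R^n_x)}$$ for every $\varphi\in L^2(\mathbb R^n)$. Here, for $\varphi$ in the domain of $|\nabla a(D_x)|^{1/2}$, the expression inside the norm is understood literally for each $t$;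 the map $\varphi\mapsto\langle x\rangle^{-s}|\nabla a(D_x)|^{1/2}e^{ita(D_x)}\varphi$ so obtained extends (uniquely) to a bounded linear operator $L^2(\mathbb R^n_x)\to L^2(\mathbb R_t\times\mathbb R^n_x)$, and for all other $\varphi\in L^2(\mathbb R^n)$ the expression denotes the value of this extension. -/

import Mathlib

open MeasureTheory Set FourierTransform
open scoped Gradient

noncomputable section

/-- The space `ℝⁿ` with its Euclidean norm. -/
abbrev Rn (n : ℕ) : Type := EuclideanSpace ℝ (Fin n)

/-- The complex Hilbert space `L²(ℝⁿ)`. -/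
abbrev L2x (n : ℕ) : Type := Lp (α := Rn n) ℂ 2 volume

/-- The complex Hilbert space `L²(ℝ_t × ℝⁿ_x)`. -/
abbrev L2tx (n : ℕ) : Type := Lp (α := ℝ × Rn n) ℂ 2 volume

/-- The bracket `⟨x⟩ = (1 + |x|²)^{1/2}`. -/
def japaneseBracket {n : ℕ} (x : Rn n) : ℝ := (1 + ‖x‖ ^ 2) ^ (1 / 2 : ℝ)

/-- The Fourier transform of `m(D_x) φ`. Mathlib's Fourier transform has the kernel
`exp (-2π i ⟨x, ξ⟩)`, so that `D_j = -i ∂_j` becomes multiplication by `2π ξ_j`, and `m(D_x)`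
becomes multiplication by `m (2π ξ)`. -/
def multipliedFourier {n : ℕ} (m : Rn n → ℂ) (φ : L2x n) : Rn n → ℂ :=
  fun ξ => m ((2 * Real.pi) • ξ) * (𝓕 φ : L2x n) ξ

/-- The natural (maximal) domain in `L²(ℝⁿ)` of the Fourier multiplier `m(D_x)`. -/
def multiplierDomain {n : ℕ} (m : Rn n → ℂ) : Set (L2x n) :=
  {φ | MemLp (multipliedFourier m φ) 2 volume}

open Classical in
/-- The Fourier multiplier `m(D_x)`, `D_x = -i ∇`, on its natural domain in `L²(ℝⁿ)`
(with the value `0` off the domain). -/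
def fourierMultiplier {n : ℕ} (m : Rn n → ℂ) (φ : L2x n) : L2x n :=
  if h : MemLp (multipliedFourier m φ) 2 volume then 𝓕⁻ (h.toLp (multipliedFourier m φ)) else 0

/-- The propagator `e^{i t a(D_x)}`. -/
def propagator {n : ℕ} (a : Rn n → ℝ) (t : ℝ) (φ : L2x n) : L2x n :=
  fourierMultiplier (fun ξ => Complex.exp (Complex.I * (t : ℂ) * (a ξ : ℂ))) φ

/-- The symbol `|∇a(ξ)|^{1/2}`. -/
def sqrtGradSymbol {n : ℕ} (a : Rn n → ℝ) : Rn n → ℂ :=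
  fun ξ => ((‖∇ a ξ‖ ^ (1 / 2 : ℝ) : ℝ) : ℂ)

end

open Filter Topology

/-! ### Plancherel for the inverse Fourier integral on L¹ ∩ L². -/

section FourierIntegral

/-! Write p(ξ) = a(2πξ)/2π, fix a direction j and freeze x_j = c. As a function of t and the other
coordinates x', the phase ⟨ξ, x⟩ + t p(ξ) is linear with frequency Φ(ξ), where Φ replaces ξ_j by
p(ξ); the remaining term c ξ_j only contributes a unimodular factor. Substituting η = Φ(ξ) and using
Plancherel in (t, x') gives exactly ∫ |h|² / |∂_j p| for the squared norm on the hyperplane,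
whatever c is (`lintegral_weight_mul_oscillatoryIntegral`). Since ⟨x⟩^{-2s} ≤ (1 + x_j²)^{-s}, which
is integrable in x_j for s > 1/2, integrating over c costs only a constant.

Here ∂_j p = f'(2π|ξ|) ξ_j/|ξ|. The factor |f'| is cancelled by the square of |∇a|^{1/2}, and the
degeneracy at ξ_j = 0 by the partition of unity ∑ ξ_j²/|ξ|² = 1. The map Φ is injective once the
sign of ξ_j is fixed and 2π|ξ| is confined between consecutive zeros of f', where Rolle makes f
injective. Finitely many zeros give finitely many such cells, and the triangle inequality adds them
up (`exists_eLpNorm_weighted_oscillatoryIntegral_le`).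

This settles the φ for which the Fourier transform of |∇a(D_x)|^{1/2} φ is integrable. They are
dense, so the operator extends by continuity. That the extension is still given by the literal
formula on the whole natural domain follows by frequency cutoffs, which commute with all
multipliers, and by comparing limits on time slices (`ae_slice_eq_of_tendsto`). -/

theorem eLpNorm_two_sq {α : Type*} [MeasurableSpace α] {μ : Measure α} (u : α → ℂ) :
    eLpNorm u 2 μ ^ 2 = ∫⁻ x, ‖u x‖ₑ ^ 2 ∂μ := by
  simpa using eLpNorm_nnreal_pow_eq_lintegral (f := u) (μ := μ) (p := 2) (by norm_num)

variable {V : Type*} [NormedAddCommGroup V] [InnerProductSpace ℝ V] [FiniteDimensional ℝ V]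
  [MeasurableSpace V] [BorelSpace V]

theorem continuous_fourierInv_of_integrable {f : V → ℂ} (hf : Integrable f) :
    Continuous (𝓕⁻ f) := by
  have h : Continuous (𝓕 f) :=
    VectorFourier.fourierIntegral_continuous Real.continuous_fourierChar continuous_inner hf
  have h' : 𝓕⁻ f = fun v => 𝓕 f (-v) := funext fun v => Real.fourierInv_eq_fourier_neg f v
  rw [h']
  exact h.comp continuous_neg

theorem integral_smul_fourierInv {f g : V → ℂ} (hf : Integrable f) (hg : Integrable g) :
    ∫ x, g x • 𝓕⁻ f x = ∫ x, 𝓕⁻ g x • f x := by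
  -- The general transform has kernel e(-L(v, w)), so taking L to be minus the inner product yields
  -- the inverse transform.
  have h := VectorFourier.integral_fourierIntegral_smul_eq_flip (L := -innerₗ V) (μ := volume)
    (ν := volume) Real.continuous_fourierChar
    (show Continuous fun p : V × V => -inner ℝ p.1 p.2 from continuous_inner.neg) hg hf
  have e1 : ∀ u : V → ℂ, VectorFourier.fourierIntegral Real.fourierChar volume (-innerₗ V) u
      = 𝓕⁻ u := by
    intro u
    ext v
    simp [VectorFourier.fourierIntegral, Real.fourierInv_eq]
  have e2 : ∀ u : V → ℂ, VectorFourier.fourierIntegral Real.fourierChar volume (-innerₗ V).flip u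
      = 𝓕⁻ u := by
    intro u
    ext v
    simp [VectorFourier.fourierIntegral, Real.fourierInv_eq, real_inner_comm]
  rw [e1, e2] at h
  exact h.symm

/-- The inverse Fourier transform of `L²` is given by the inverse Fourier integral on `L¹ ∩ L²`. -/
theorem fourierInv_toLp_ae_eq {f : V → ℂ} (hf : Integrable f) (hf2 : MemLp f 2) :
    ((𝓕⁻ (hf2.toLp f) : Lp (α := V) ℂ 2) : V → ℂ) =ᵐ[volume] 𝓕⁻ f := by
  -- Both sides are tested against smooth compactly supported g. The L² transform agrees with the
  -- distributional one, so either pairing becomes the integral of f against 𝓕⁻ g.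
  refine ae_eq_of_integral_contDiff_smul_eq
    ((Lp.memLp (𝓕⁻ (hf2.toLp f))).locallyIntegrable (by norm_num))
    (continuous_fourierInv_of_integrable hf).locallyIntegrable fun g hg hgc => ?_
  have hgc' : HasCompactSupport (fun x => (g x : ℂ)) := hgc.comp_left Complex.ofReal_zero
  have hg' : ContDiff ℝ (⊤ : ℕ∞) (fun x => (g x : ℂ)) := Complex.ofRealCLM.contDiff.comp hg
  set ψ : SchwartzMap V ℂ := hgc'.toSchwartzMap hg' with hψ
  have h1 : ∀ u : V → ℂ, ∫ x, g x • u x = ∫ x, ψ x • u x := by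
    intro u
    congr 1
  rw [h1, h1, integral_smul_fourierInv hf (ψ.integrable (μ := volume)), ← Lp.toTemperedDistribution_apply,
    ← Lp.fourierInv_toTemperedDistribution_eq, TemperedDistribution.fourierInv_apply,
    Lp.toTemperedDistribution_apply]
  refine integral_congr_ae ?_
  filter_upwards [hf2.coeFn_toLp] with x hx
  rw [hx, SchwartzMap.fourierInv_coe]

/-- **Plancherel's theorem** on `L¹ ∩ L²`. -/
theorem eLpNorm_fourierInv {f : V → ℂ} (hf : Integrable f) (hf2 : MemLp f 2) :
    eLpNorm (𝓕⁻ f) 2 volume = eLpNorm f 2 volume := by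
  rw [← eLpNorm_congr_ae (fourierInv_toLp_ae_eq hf hf2), ← eLpNorm_congr_ae hf2.coeFn_toLp,
    ← Lp.enorm_def, ← Lp.enorm_def]
  have h := (Lp.fourierTransformₗᵢ V ℂ).symm.norm_map (hf2.toLp f)
  rw [← ofReal_norm, ← ofReal_norm, ← h]
  rfl

end FourierIntegral

/-! ### Plancherel after a nonlinear change of frequency variables. -/

section ChangeOfVariables

theorem enorm_fourierChar_smul (r : ℝ) (z : ℂ) : ‖Real.fourierChar r • z‖ₑ = ‖z‖ₑ := by
  rw [← ofReal_norm, ← ofReal_norm, Circle.norm_smul]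

variable {V : Type*} [NormedAddCommGroup V] [InnerProductSpace ℝ V] [FiniteDimensional ℝ V]
  [MeasurableSpace V] [BorelSpace V]

/-- Plancherel's theorem for an oscillatory integral with phase `⟪Φ ξ, y⟫`, after the change of
variables `η = Φ ξ`. -/
theorem lintegral_enorm_sq_oscillatory_integral {Ω : Set V} (hΩ : MeasurableSet Ω) {Φ : V → V}
    {Φ' : V → V →L[ℝ] V} (hΦ : ∀ ξ ∈ Ω, HasFDerivWithinAt Φ (Φ' ξ) Ω ξ) (hinj : InjOn Φ Ω)
    (hdet : ∀ ξ ∈ Ω, (Φ' ξ).det ≠ 0) {h : V → ℂ} (hh : IntegrableOn h Ω)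
    (hW : ∫⁻ ξ in Ω, ‖h ξ‖ₑ ^ 2 / ENNReal.ofReal |(Φ' ξ).det| ≠ ⊤) :
    ∫⁻ y, ‖∫ ξ in Ω, Real.fourierChar (inner ℝ (Φ ξ) y) • h ξ‖ₑ ^ 2 =
      ∫⁻ ξ in Ω, ‖h ξ‖ₑ ^ 2 / ENNReal.ofReal |(Φ' ξ).det| := by
  -- The density of the push-forward of h under Φ, so that the oscillatory integral is the inverse
  -- Fourier transform of H extended by zero off Φ(Ω).
  set H : V → ℂ := fun η => |(Φ' (Function.invFunOn Φ Ω η)).det|⁻¹ • h (Function.invFunOn Φ Ω η)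
    with hH
  have hHΦ : ∀ ξ ∈ Ω, H (Φ ξ) = |(Φ' ξ).det|⁻¹ • h ξ := by
    intro ξ hξ
    simp only [hH, hinj.leftInvOn_invFunOn hξ]
  have hpos : ∀ ξ ∈ Ω, 0 < |(Φ' ξ).det| := fun ξ hξ => abs_pos.2 (hdet ξ hξ)
  have himg : MeasurableSet (Φ '' Ω) := measurable_image_of_fderivWithin hΩ hΦ hinj
  have hHint : IntegrableOn H (Φ '' Ω) := by
    rw [integrableOn_image_iff_integrableOn_abs_det_fderiv_smul volume hΩ hΦ hinj]
    refine hh.congr_fun (fun ξ hξ => ?_) hΩ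
    simp only [hHΦ ξ hξ, smul_smul, mul_inv_cancel₀ (hpos ξ hξ).ne', one_smul]
  have hGint : Integrable ((Φ '' Ω).indicator H) := (integrable_indicator_iff himg).2 hHint
  have hGsq : ∫⁻ η, ‖(Φ '' Ω).indicator H η‖ₑ ^ 2 =
      ∫⁻ ξ in Ω, ‖h ξ‖ₑ ^ 2 / ENNReal.ofReal |(Φ' ξ).det| := by
    have e : (fun η => ‖(Φ '' Ω).indicator H η‖ₑ ^ 2) =
        (Φ '' Ω).indicator fun η => ‖H η‖ₑ ^ 2 := by
      ext η
      by_cases hη : η ∈ Φ '' Ω <;> simp [hη]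
    rw [e, lintegral_indicator himg,
      lintegral_image_eq_lintegral_abs_det_fderiv_mul volume hΩ hΦ hinj]
    -- Squaring H gives |det|⁻², and the change of variables restores one factor |det|.
    refine setLIntegral_congr_fun hΩ fun ξ hξ => ?_
    have hd : ENNReal.ofReal |(Φ' ξ).det| ≠ 0 := by simpa using hdet ξ hξ
    simp only [hHΦ ξ hξ, enorm_smul, enorm_inv (hpos ξ hξ).ne']
    rw [Real.enorm_of_nonneg (abs_nonneg _), mul_pow, sq, ENNReal.div_eq_inv_mul, ← mul_assoc,
      ← mul_assoc, ENNReal.mul_inv_cancel hd ENNReal.ofReal_ne_top, one_mul]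
  have hG2 : MemLp ((Φ '' Ω).indicator H) 2 := by
    refine ⟨hGint.aestronglyMeasurable, ?_⟩
    rw [eLpNorm_lt_top_iff_lintegral_rpow_enorm_lt_top (by norm_num) (by norm_num)]
    simpa [hGsq] using hW.lt_top
  have hP := eLpNorm_fourierInv hGint hG2
  rw [← hGsq, ← eLpNorm_two_sq ((Φ '' Ω).indicator H), ← hP, eLpNorm_two_sq]
  refine lintegral_congr fun y => ?_
  have e : (fun η => Real.fourierChar (inner ℝ η y) • (Φ '' Ω).indicator H η) =
      (Φ '' Ω).indicator fun η => Real.fourierChar (inner ℝ η y) • H η := by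
    ext η
    by_cases hη : η ∈ Φ '' Ω <;> simp [hη]
  rw [Real.fourierInv_eq, e, integral_indicator himg,
    integral_image_eq_integral_abs_det_fderiv_smul volume hΩ hΦ hinj]
  congr 2
  refine setIntegral_congr_fun hΩ fun ξ hξ => ?_
  simp only [hHΦ ξ hξ]
  rw [smul_comm (Real.fourierChar _), smul_smul, mul_inv_cancel₀ (hpos ξ hξ).ne', one_smul]

theorem integrable_fourierChar_smul {α : Type*} [MeasurableSpace α] {μ : Measure α} {p : α → ℝ}
    (hp : Measurable p) {h : α → ℂ} (hh : Integrable h μ) :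
    Integrable (fun ξ => Real.fourierChar (p ξ) • h ξ) μ := by
  refine hh.norm.mono' (AEStronglyMeasurable.smul (f := fun ξ => Real.fourierChar (p ξ)) ?_
    hh.aestronglyMeasurable) (.of_forall fun ξ => by simp)
  exact Real.continuous_fourierChar.comp_aestronglyMeasurable hp.aestronglyMeasurable

end ChangeOfVariables

/-! ### Exchanging time with one space coordinate. -/

section CoordinateExchange

variable {n : ℕ}

/-- Replace the `j`-th coordinate of `ξ` by `c`. -/
noncomputable def replaceCoord (j : Fin n) (ξ : Rn n) (c : ℝ) : Rn n := ξ + (c - ξ j) • EuclideanSpace.single j 1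

theorem replaceCoord_apply (j : Fin n) (ξ : Rn n) (c : ℝ) (i : Fin n) :
    replaceCoord j ξ c i = if i = j then c else ξ i := by
  by_cases h : i = j
  · subst h
    simp [replaceCoord]
  · simp [replaceCoord, h]

/-- The linear involution of `ℝ × ℝⁿ` that exchanges the first factor with the `j`-th coordinate. -/
noncomputable def exchangeCoord (j : Fin n) : (ℝ × Rn n) →ₗ[ℝ] (ℝ × Rn n) where
  toFun q := (q.2 j, replaceCoord j q.2 q.1)
  map_add' p q := by
    ext i
    · simp
    · simp only [replaceCoord_apply, Prod.snd_add, Prod.fst_add, PiLp.add_apply]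
      split_ifs <;> rfl
  map_smul' c q := by
    ext i
    · simp
    · simp only [replaceCoord_apply, Prod.smul_snd, Prod.smul_fst, PiLp.smul_apply,
        RingHom.id_apply]
      split_ifs <;> rfl

theorem exchangeCoord_apply (j : Fin n) (q : ℝ × Rn n) :
    exchangeCoord j q = (q.2 j, replaceCoord j q.2 q.1) := rfl

theorem exchangeCoord_comp_self (j : Fin n) : exchangeCoord j ∘ₗ exchangeCoord j = .id := by
  refine LinearMap.ext fun q => Prod.ext ?_ ?_
  · simp [exchangeCoord_apply, replaceCoord_apply]
  · ext i
    simp only [LinearMap.comp_apply, exchangeCoord_apply, replaceCoord_apply, LinearMap.id_apply]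
    split_ifs with h
    · rw [h]
    · rfl

/-- A linear involution has determinant ±1. -/
theorem measurePreserving_exchangeCoord (j : Fin n) :
    MeasurePreserving (exchangeCoord j) (volume : Measure (ℝ × Rn n)) volume := by
  have hdet : LinearMap.det (exchangeCoord j) * LinearMap.det (exchangeCoord j) = 1 := by
    rw [← LinearMap.det_comp, exchangeCoord_comp_self, LinearMap.det_id]
  have h0 : LinearMap.det (exchangeCoord j) ≠ 0 := left_ne_zero_of_mul_eq_one hdet
  refine ⟨(LinearMap.continuous_of_finiteDimensional _).measurable, ?_⟩
  have : (volume : Measure (ℝ × Rn n)).IsAddHaarMeasure :=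
    inferInstanceAs ((volume : Measure ℝ).prod (volume : Measure (Rn n))).IsAddHaarMeasure
  rw [Measure.map_linearMap_addHaar_eq_smul_addHaar volume h0]
  rcases mul_self_eq_one_iff.1 hdet with h | h <;> simp [h]

/-- Fubini with x_j as the outer variable; in the inner variable y the j-th slot holds the time. -/
theorem lintegral_mul_comp_exchangeCoord (j : Fin n) {w : ℝ → ENNReal} (hw : Measurable w)
    {G : ℝ × Rn n → ENNReal} (hG : Measurable G) :
    ∫⁻ q : ℝ × Rn n, w (q.2 j) * G (exchangeCoord j q) = ∫⁻ c, w c * ∫⁻ y, G (c, y) := by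
  have h := (measurePreserving_exchangeCoord j).lintegral_comp
    (f := fun q : ℝ × Rn n => w q.1 * G q) (by fun_prop)
  simp only [exchangeCoord_apply] at h ⊢
  rw [h, Measure.volume_eq_prod, lintegral_prod _ (by fun_prop)]
  refine lintegral_congr fun c => ?_
  exact lintegral_const_mul (w c) (hG.comp measurable_prodMk_left)

end CoordinateExchange

/-! ### The exact identity on hyperplanes x_j = c. -/

section DirectionalSmoothing

variable {n : ℕ}

/-- The oscillatory integral `∫_Ω exp (2π i (⟨ξ, x⟩ + t p(ξ))) h(ξ) dξ` at `q = (t, x)`. -/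
noncomputable def oscillatoryIntegral (p : Rn n → ℝ) (Ω : Set (Rn n)) (h : Rn n → ℂ) (q : ℝ × Rn n) : ℂ :=
  ∫ ξ in Ω, Real.fourierChar (inner ℝ ξ q.2 + q.1 * p ξ) • h ξ

theorem continuous_oscillatoryIntegral {p : Rn n → ℝ} (hp : Measurable p) {Ω : Set (Rn n)}
    {h : Rn n → ℂ} (hh : IntegrableOn h Ω) : Continuous (oscillatoryIntegral p Ω h) := by
  refine continuous_of_dominated (bound := fun ξ => ‖h ξ‖) (fun q => ?_) (fun q => ?_) hh.norm ?_
  · exact (integrable_fourierChar_smul (by fun_prop) hh).aestronglyMeasurable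
  · exact .of_forall fun ξ => by simp
  · refine .of_forall fun ξ => ?_
    have : Continuous fun q : ℝ × Rn n => Real.fourierChar (inner ℝ ξ q.2 + q.1 * p ξ) :=
      Real.continuous_fourierChar.comp (by fun_prop)
    exact this.smul continuous_const

/-- This is the Jacobian of ξ ↦ `replaceCoord j ξ (p ξ)` with ℓ = dp: the map is a transvection, of
determinant 1 + (ℓ - proj_j)(e_j), and proj_j(e_j) = 1. -/
theorem det_id_add_smulRight_single (j : Fin n) (ℓ : Rn n →L[ℝ] ℝ) :
    (ContinuousLinearMap.id ℝ (Rn n) +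
      (ℓ - EuclideanSpace.proj j).smulRight (EuclideanSpace.single j (1 : ℝ))).det =
    ℓ (EuclideanSpace.single j 1) := by
  have h := LinearMap.transvection.det (R := ℝ) (V := Rn n)
    (((ℓ - EuclideanSpace.proj j : Rn n →L[ℝ] ℝ)) : Rn n →ₗ[ℝ] ℝ) (EuclideanSpace.single j (1 : ℝ))
  have e : ((ContinuousLinearMap.id ℝ (Rn n) +
      (ℓ - EuclideanSpace.proj j).smulRight (EuclideanSpace.single j (1 : ℝ)) :
        Rn n →L[ℝ] Rn n) : Rn n →ₗ[ℝ] Rn n) = LinearMap.transvection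
    (((ℓ - EuclideanSpace.proj j : Rn n →L[ℝ] ℝ)) : Rn n →ₗ[ℝ] ℝ)
      (EuclideanSpace.single j (1 : ℝ)) := by
    ext v
    simp [LinearMap.transvection.apply]
  rw [ContinuousLinearMap.det, e, h]
  simp

/-- Smoothing in the direction `j`: the `L²(t, x')` norm of the oscillatory integral on a
hyperplane `x_j = c` does not depend on `c`. -/
theorem lintegral_weight_mul_oscillatoryIntegral (j : Fin n) {p : Rn n → ℝ} (hp : Measurable p)
    {p' : Rn n → Rn n →L[ℝ] ℝ} {Ω : Set (Rn n)} (hΩ : MeasurableSet Ω)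
    (hpd : ∀ ξ ∈ Ω, HasFDerivAt p (p' ξ) ξ) (hinj : InjOn (fun ξ => replaceCoord j ξ (p ξ)) Ω)
    (hne : ∀ ξ ∈ Ω, p' ξ (EuclideanSpace.single j 1) ≠ 0) {h : Rn n → ℂ} (hh : IntegrableOn h Ω)
    (hW : ∫⁻ ξ in Ω, ‖h ξ‖ₑ ^ 2 / ENNReal.ofReal |p' ξ (EuclideanSpace.single j 1)| ≠ ⊤)
    {w : ℝ → ENNReal} (hw : Measurable w) :
    ∫⁻ q : ℝ × Rn n, w (q.2 j) * ‖oscillatoryIntegral p Ω h q‖ₑ ^ 2 =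
      (∫⁻ c, w c) *
        ∫⁻ ξ in Ω, ‖h ξ‖ₑ ^ 2 / ENNReal.ofReal |p' ξ (EuclideanSpace.single j 1)| := by
  set W := ∫⁻ ξ in Ω, ‖h ξ‖ₑ ^ 2 / ENNReal.ofReal |p' ξ (EuclideanSpace.single j 1)|
  have hinv : ∀ q, exchangeCoord j (exchangeCoord j q) = q := fun q =>
    LinearMap.congr_fun (exchangeCoord_comp_self j) q
  have hG : Measurable fun q => ‖oscillatoryIntegral p Ω h (exchangeCoord j q)‖ₑ ^ 2 :=
    (((continuous_oscillatoryIntegral hp hh).comp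
      (LinearMap.continuous_of_finiteDimensional (exchangeCoord j))).measurable.enorm).pow_const 2
  -- The exchange is applied twice, so that the integrand on the left is the original one.
  have h1 := lintegral_mul_comp_exchangeCoord j hw hG
  simp only [hinv] at h1
  rw [h1, ← lintegral_mul_const _ hw]
  refine lintegral_congr fun c => ?_
  congr 1
  set Φ' : Rn n → Rn n →L[ℝ] Rn n := fun ξ => ContinuousLinearMap.id ℝ (Rn n) +
      (p' ξ - EuclideanSpace.proj j).smulRight (EuclideanSpace.single j (1 : ℝ)) with hΦ'
  have hdet : ∀ ξ, (Φ' ξ).det = p' ξ (EuclideanSpace.single j 1) := fun ξ =>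
    det_id_add_smulRight_single j (p' ξ)
  have hΦ : ∀ ξ ∈ Ω, HasFDerivWithinAt (fun ξ => replaceCoord j ξ (p ξ)) (Φ' ξ) Ω ξ := by
    intro ξ hξ
    exact ((hasFDerivAt_id ξ).add (((hpd ξ hξ).sub
      (EuclideanSpace.proj (𝕜 := ℝ) j).hasFDerivAt).smul_const _)).hasFDerivWithinAt
  -- The frozen coordinate enters only through e(c ξ_j), which is absorbed into h without changing
  -- its modulus; hence the independence of c.
  have hc : IntegrableOn (fun ξ : Rn n => Real.fourierChar (c * ξ j) • h ξ) Ω :=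
    integrable_fourierChar_smul (by fun_prop) hh
  have key := lintegral_enorm_sq_oscillatory_integral hΩ hΦ hinj
    (fun ξ hξ => (hdet ξ).trans_ne (hne ξ hξ)) hc (by simpa only [hdet, enorm_fourierChar_smul] using hW)
  simp only [hdet, enorm_fourierChar_smul] at key
  refine Eq.trans (lintegral_congr fun y => ?_) key
  congr 2
  refine integral_congr_ae (.of_forall fun ξ => ?_)
  simp only [exchangeCoord_apply, smul_smul, Circle.smul_def, ← Circle.coe_mul,
    ← AddChar.map_add_eq_mul]
  congr 3
  simp only [replaceCoord, inner_add_left, inner_add_right, inner_smul_left, inner_smul_right,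
    EuclideanSpace.inner_single_left, EuclideanSpace.inner_single_right]
  simp
  ring

end DirectionalSmoothing

/-! ### Derivatives and measurability of the radial symbol. -/

section RadialSymbol

variable {n : ℕ} {f : ℝ → ℝ} {a : Rn n → ℝ}

theorem hasFDerivAt_radial (hf : ContDiffOn ℝ 1 f (Ioi 0)) (ha : ∀ ξ : Rn n, ξ ≠ 0 → a ξ = f ‖ξ‖)
    {ξ : Rn n} (hξ : ξ ≠ 0) :
    HasFDerivAt a ((deriv f ‖ξ‖ * ‖ξ‖⁻¹) • innerSL ℝ ξ) ξ := by
  have hpos : 0 < ‖ξ‖ := norm_pos_iff.2 hξ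
  have h1 : HasFDerivAt (fun η : Rn n => ‖η‖) (‖ξ‖⁻¹ • innerSL ℝ ξ) ξ := by
    have h := ((hasStrictFDerivAt_norm_sq ξ).hasFDerivAt).sqrt (by positivity)
    simp only [Real.sqrt_sq (norm_nonneg _)] at h
    convert! h using 1
    ext v
    simp
    field_simp
  have h2 : HasDerivAt f (deriv f ‖ξ‖) ‖ξ‖ :=
    ((hf.differentiableOn one_ne_zero).differentiableAt (Ioi_mem_nhds hpos)).hasDerivAt
  have h3 := h2.comp_hasFDerivAt ξ h1
  rw [smul_smul] at h3
  refine h3.congr_of_eventuallyEq ?_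
  filter_upwards [isOpen_ne.mem_nhds hξ] with η hη
  exact ha η hη

theorem norm_gradient_radial (hf : ContDiffOn ℝ 1 f (Ioi 0))
    (ha : ∀ ξ : Rn n, ξ ≠ 0 → a ξ = f ‖ξ‖) {ξ : Rn n} (hξ : ξ ≠ 0) :
    ‖∇ a ξ‖ = |deriv f ‖ξ‖| := by
  have h := (InnerProductSpace.toDual ℝ (Rn n)).norm_map (∇ a ξ)
  rw [toDual_gradient, (hasFDerivAt_radial hf ha hξ).fderiv, norm_smul, innerSL_apply_norm,
    norm_mul, norm_inv, norm_norm, mul_assoc, inv_mul_cancel₀ (norm_ne_zero_iff.2 hξ), mul_one,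
    Real.norm_eq_abs] at h
  exact h.symm

theorem enorm_sqrtGradSymbol_sq (hf : ContDiffOn ℝ 1 f (Ioi 0))
    (ha : ∀ ξ : Rn n, ξ ≠ 0 → a ξ = f ‖ξ‖) {ξ : Rn n} (hξ : ξ ≠ 0) :
    ‖sqrtGradSymbol a ξ‖ₑ ^ 2 = ENNReal.ofReal |deriv f ‖ξ‖| := by
  rw [sqrtGradSymbol, norm_gradient_radial hf ha hξ, ← ofReal_norm, Complex.norm_real,
    Real.norm_of_nonneg (by positivity), ← ENNReal.ofReal_pow (by positivity), ← Real.sqrt_eq_rpow,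
    Real.sq_sqrt (abs_nonneg _)]

theorem measurable_sqrtGradSymbol (a : Rn n → ℝ) : Measurable (sqrtGradSymbol a) := by
  have h : (fun ξ => ‖∇ a ξ‖) = fun ξ => ‖fderiv ℝ a ξ‖ := by
    ext ξ
    rw [← toDual_gradient, LinearIsometryEquiv.norm_map]
  have h' : Measurable fun ξ => ‖∇ a ξ‖ := h ▸ (measurable_fderiv ℝ a).norm
  exact Complex.measurable_ofReal.comp (h'.pow_const _)

/-- The symbol is continuous off the origin, and its arbitrary value at one point does not affect
measurability. -/
theorem measurable_radial (hf : ContDiffOn ℝ 1 f (Ioi 0))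
    (ha : ∀ ξ : Rn n, ξ ≠ 0 → a ξ = f ‖ξ‖) : Measurable a :=
  measurable_of_continuousOn_compl_singleton 0 fun _ hξ =>
    (hasFDerivAt_radial hf ha hξ).continuousAt.continuousWithinAt

/-- The symbol `a(D_x) / 2π`, in the normalisation of Mathlib's Fourier transform. -/
noncomputable def rescaledSymbol (a : Rn n → ℝ) (ξ : Rn n) : ℝ :=
  a ((2 * Real.pi) • ξ) / (2 * Real.pi)

theorem measurable_rescaledSymbol (ha : Measurable a) : Measurable (rescaledSymbol a) :=
  (ha.comp (measurable_const_smul _)).div_const _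

/-- The two factors 2π cancel, so this gradient at ξ is that of a at 2πξ and has length |f'(2π|ξ|)|.
-/
theorem hasFDerivAt_rescaledSymbol (hf : ContDiffOn ℝ 1 f (Ioi 0))
    (ha : ∀ ξ : Rn n, ξ ≠ 0 → a ξ = f ‖ξ‖) {ξ : Rn n} (hξ : ξ ≠ 0) :
    HasFDerivAt (rescaledSymbol a)
      ((deriv f ‖(2 * Real.pi) • ξ‖ * ‖ξ‖⁻¹) • innerSL ℝ ξ) ξ := by
  have hpi : 2 * Real.pi ≠ 0 := by positivity
  have h1 : HasFDerivAt (fun ξ : Rn n => (2 * Real.pi) • ξ)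
      ((2 * Real.pi) • ContinuousLinearMap.id ℝ (Rn n)) ξ := 
    (hasFDerivAt_id ξ).fun_const_smul _
  have h2 := ((hasFDerivAt_radial hf ha (smul_ne_zero hpi hξ)).comp ξ h1).mul_const
    (2 * Real.pi)⁻¹
  convert! h2 using 1
  ext v
  simp [norm_smul, abs_of_pos Real.pi_pos]
  field_simp

end RadialSymbol

/-! ### Decomposition of frequency space into cells of injectivity. -/

section Cells

variable {n : ℕ}

/-- The number of points of `Z` on the left of `r`. -/
noncomputable def countBelow (Z : Finset ℝ) (r : ℝ) : ℕ := (Z.filter (· < r)).card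

theorem monotone_countBelow (Z : Finset ℝ) : Monotone (countBelow Z) := fun _ _ h =>
  Finset.card_le_card (Finset.monotone_filter_right Z fun _ _ hz => hz.trans_le h)

theorem countBelow_lt (Z : Finset ℝ) (r : ℝ) : countBelow Z r < Z.card + 1 :=
  Nat.lt_succ_of_le (Finset.card_filter_le _ _)

/-- If all positive zeros of `f'` lie in `Z`, then `f` is injective on each interval of the
complement of `Z`. -/
theorem eq_of_countBelow_eq {f : ℝ → ℝ} (hf : ContDiffOn ℝ 1 f (Ioi 0)) {Z : Finset ℝ}
    (hZ : ∀ r, 0 < r → deriv f r = 0 → r ∈ Z) {r r' : ℝ} (hr : 0 < r) (hr' : 0 < r')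
    (hc : countBelow Z r = countBelow Z r') (hrr : deriv f r ≠ 0) (hrr' : deriv f r' ≠ 0)
    (heq : f r = f r') : r = r' := by
  wlog hlt : r < r' generalizing r r'
  · rcases (not_lt.1 hlt).eq_or_lt with h | h
    · exact h.symm
    · exact (this hr' hr hc.symm hrr' hrr heq.symm h).symm
  -- Rolle produces a zero of f' strictly between r and r'; it is counted below r' but not below r.
  have hcont : ContinuousOn f (Icc r r') :=
    hf.continuousOn.mono fun x hx => hr.trans_le hx.1
  obtain ⟨c, hc1, hc2⟩ := exists_deriv_eq_zero hlt hcont heq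
  have hcZ := hZ c (hr.trans hc1.1) hc2
  have : countBelow Z r < countBelow Z r' := by
    refine Finset.card_lt_card (Finset.ssubset_iff_of_subset
      (Finset.monotone_filter_right Z fun _ _ hz => hz.trans hlt) |>.2 ⟨c, ?_, ?_⟩)
    · simp [hcZ, hc1.2]
    · simp [hc1.1.le]
  omega

/-- The regions on which the change of variables replacing `ξ_j` by `f(2π|ξ|) / 2π` is a
diffeomorphism onto its image. -/
def frequencyCell (f : ℝ → ℝ) (Z : Finset ℝ) (i : Fin n × Bool × Fin (Z.card + 1)) : Set (Rn n) :=
  {ξ | (ξ i.1 ≠ 0 ∧ deriv f ‖(2 * Real.pi) • ξ‖ ≠ 0) ∧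
    (decide (0 < ξ i.1) = i.2.1 ∧ countBelow Z ‖(2 * Real.pi) • ξ‖ = i.2.2)}

theorem measurableSet_frequencyCell (f : ℝ → ℝ) (Z : Finset ℝ)
    (i : Fin n × Bool × Fin (Z.card + 1)) : MeasurableSet (frequencyCell f Z i) := by
  have h1 : Measurable fun ξ : Rn n => ξ i.1 := by fun_prop
  have h2 : Measurable fun ξ : Rn n => ‖(2 * Real.pi) • ξ‖ := by fun_prop
  refine MeasurableSet.inter (MeasurableSet.inter ?_ ?_) (MeasurableSet.inter ?_ ?_)
  · exact (h1 (measurableSet_singleton 0)).compl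
  · exact (((measurable_deriv f).comp h2) (measurableSet_singleton 0)).compl
  · have h3 : MeasurableSet {ξ : Rn n | 0 < ξ i.1} := measurableSet_lt measurable_const h1
    have h4 : ∀ b, MeasurableSet {ξ : Rn n | decide (0 < ξ i.1) = b} := by
      rintro (_ | _)
      · simpa only [decide_eq_false_iff_not] using! h3.compl
      · simpa only [decide_eq_true_eq] using h3
    exact h4 i.2.1
  · exact ((monotone_countBelow Z).measurable.comp h2) (measurableSet_singleton _)

theorem ne_zero_of_mem_frequencyCell {f : ℝ → ℝ} {Z : Finset ℝ}
    {i : Fin n × Bool × Fin (Z.card + 1)} {ξ : Rn n} (hξ : ξ ∈ frequencyCell f Z i) : ξ ≠ 0 := by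
  rintro rfl
  exact hξ.1.1 rfl

/-- Equal images share all coordinates but the j-th and the value f(2π|ξ|). Injectivity of f on the
cell's radii gives equal norms, hence equal ξ_j², and the sign fixed on the cell decides between
±ξ_j. -/
theorem injOn_replaceCoord_frequencyCell {f : ℝ → ℝ} (hf : ContDiffOn ℝ 1 f (Ioi 0))
    {a : Rn n → ℝ} (ha : ∀ ξ : Rn n, ξ ≠ 0 → a ξ = f ‖ξ‖) {Z : Finset ℝ}
    (hZ : ∀ r, 0 < r → deriv f r = 0 → r ∈ Z) (i : Fin n × Bool × Fin (Z.card + 1)) :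
    InjOn (fun ξ => replaceCoord i.1 ξ (rescaledSymbol a ξ)) (frequencyCell f Z i) := by
  intro ξ hξ η hη heq
  have hpi : (0 : ℝ) < 2 * Real.pi := by positivity
  have hcoord : ∀ k, k ≠ i.1 → ξ k = η k := by
    intro k hk
    simpa [replaceCoord_apply, hk] using congrArg (fun v : Rn n => v k) heq
  have hp : rescaledSymbol a ξ = rescaledSymbol a η := by
    simpa [replaceCoord_apply] using congrArg (fun v : Rn n => v i.1) heq
  have hξ0 := smul_ne_zero hpi.ne' (ne_zero_of_mem_frequencyCell hξ)
  have hη0 := smul_ne_zero hpi.ne' (ne_zero_of_mem_frequencyCell hη)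
  rw [rescaledSymbol, rescaledSymbol, div_left_inj' hpi.ne', ha _ hξ0, ha _ hη0] at hp
  have hnorm := eq_of_countBelow_eq hf hZ (norm_pos_iff.2 hξ0) (norm_pos_iff.2 hη0)
    (hξ.2.2.trans hη.2.2.symm) hξ.1.2 hη.1.2 hp
  rw [norm_smul, norm_smul, mul_right_inj' (norm_ne_zero_iff.2 hpi.ne')] at hnorm
  have hsq : ξ i.1 ^ 2 = η i.1 ^ 2 := by
    have h := congrArg (· ^ 2) hnorm
    simp only [EuclideanSpace.real_norm_sq_eq] at h
    rw [← Finset.add_sum_erase _ _ (Finset.mem_univ i.1),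
      ← Finset.add_sum_erase Finset.univ (fun k => η k ^ 2) (Finset.mem_univ i.1),
      Finset.sum_congr rfl fun k hk => by rw [hcoord k (Finset.ne_of_mem_erase hk)]] at h
    exact add_right_cancel h
  have hsign : 0 < ξ i.1 ↔ 0 < η i.1 := decide_eq_decide.1 (hξ.2.1.trans hη.2.1.symm)
  ext k
  by_cases hk : k = i.1
  · subst hk
    rcases sq_eq_sq_iff_eq_or_eq_neg.1 hsq with h | h
    · exact h
    · have h1 := hξ.1.1
      have h2 := hη.1.1
      rcases lt_or_gt_of_ne h2 with h3 | h3
      · have := hsign.1 (by linarith)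
        linarith
      · have := hsign.2 h3
        linarith
  · exact hcoord k hk

/-- For each j with ξ_j ≠ 0 exactly one sign and one count fit ξ, and the directions with ξ_j = 0
have weight zero; what remains is ∑ ξ_j² = |ξ|². -/
theorem sum_indicator_frequencyCell {f : ℝ → ℝ} {Z : Finset ℝ} {ξ : Rn n} (hξ : ξ ≠ 0)
    (hd : deriv f ‖(2 * Real.pi) • ξ‖ ≠ 0) (z : ℂ) :
    ∑ i : Fin n × Bool × Fin (Z.card + 1),
      (frequencyCell f Z i).indicator (fun η => ((η i.1 ^ 2 / ‖η‖ ^ 2 : ℝ) : ℂ) * z) ξ = z := by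
  rw [Fintype.sum_prod_type]
  have h1 : ∀ j : Fin n, ∑ l : Bool × Fin (Z.card + 1),
      (frequencyCell f Z (j, l)).indicator (fun η => ((η j ^ 2 / ‖η‖ ^ 2 : ℝ) : ℂ) * z) ξ =
      ((ξ j ^ 2 / ‖ξ‖ ^ 2 : ℝ) : ℂ) * z := by
    intro j
    by_cases hj : ξ j = 0
    · refine (Finset.sum_eq_zero fun l _ => ?_).trans (by simp [hj])
      exact indicator_of_notMem (fun hmem => hmem.1.1 hj) _
    set l₀ : Bool × Fin (Z.card + 1) :=
      (decide (0 < ξ j), ⟨_, countBelow_lt Z ‖(2 * Real.pi) • ξ‖⟩) with hl₀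
    have hmem₀ : ξ ∈ frequencyCell f Z (j, l₀) := ⟨⟨hj, hd⟩, rfl, rfl⟩
    rw [Finset.sum_eq_single l₀]
    · exact indicator_of_mem hmem₀ _
    · rintro ⟨b, k⟩ - hne
      refine indicator_of_notMem (fun hmem => hne ?_) _
      exact Prod.ext hmem.2.1.symm (Fin.ext hmem.2.2.symm)
    · simp
  rw [Finset.sum_congr rfl fun j _ => h1 j, ← Finset.sum_mul, ← Complex.ofReal_sum,
    ← Finset.sum_div, ← EuclideanSpace.real_norm_sq_eq, div_self, Complex.ofReal_one, one_mul]
  simpa using hξ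

end Cells

/-! ### The weighted estimate for integrable frequency profiles. -/

section SmoothingEstimate

variable {n : ℕ}

theorem lintegral_one_add_sq_rpow_neg_lt_top {s : ℝ} (hs : 1 / 2 < s) :
    ∫⁻ c : ℝ, ENNReal.ofReal ((1 + c ^ 2) ^ (-s)) < ⊤ := by
  have h := integrable_rpow_neg_one_add_norm_sq (E := ℝ) (μ := volume) (r := 2 * s)
    (by rw [Module.finrank_self]; push_cast; linarith)
  have e : (fun c : ℝ => (1 + c ^ 2) ^ (-s)) = fun c => ((1 : ℝ) + ‖c‖ ^ 2) ^ (-(2 * s) / 2) := by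
    ext c
    rw [Real.norm_eq_abs, sq_abs]
    congr 1
    ring
  rw [← e] at h
  exact h.lintegral_lt_top

theorem enorm_japaneseBracket_rpow_sq_le {s : ℝ} (hs : 0 ≤ s) (x : Rn n) (j : Fin n) :
    ‖((japaneseBracket x ^ (-s) : ℝ) : ℂ)‖ₑ ^ 2 ≤ ENNReal.ofReal ((1 + x j ^ 2) ^ (-s)) := by
  have h1 : x j ^ 2 ≤ ‖x‖ ^ 2 := by
    rw [EuclideanSpace.real_norm_sq_eq]
    exact Finset.single_le_sum (f := fun i => x i ^ 2) (fun i _ => sq_nonneg _) (Finset.mem_univ j)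
  have hb : 0 ≤ japaneseBracket x := Real.rpow_nonneg (by positivity) _
  rw [← ofReal_norm, Complex.norm_real, Real.norm_of_nonneg (Real.rpow_nonneg hb _),
    ← ENNReal.ofReal_pow (Real.rpow_nonneg hb _)]
  refine ENNReal.ofReal_le_ofReal ?_
  rw [japaneseBracket, ← Real.rpow_mul (by positivity), ← Real.rpow_mul_natCast (by positivity)]
  have e : 1 / 2 * -s * ((2 : ℕ) : ℝ) = -s := by push_cast; ring
  rw [e]
  exact Real.rpow_le_rpow_of_nonpos (by positivity) (by linarith) (by linarith)

theorem continuous_japaneseBracket_rpow (s : ℝ) :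
    Continuous fun x : Rn n => ((japaneseBracket x ^ s : ℝ) : ℂ) := by
  have h1 : ∀ x : Rn n, (1 + ‖x‖ ^ 2 : ℝ) ≠ 0 := fun x => by positivity
  have h2 : Continuous fun x : Rn n => japaneseBracket x :=
    Continuous.rpow_const (by fun_prop) fun x => Or.inl (h1 x)
  refine Complex.continuous_ofReal.comp (h2.rpow_const fun x => Or.inl ?_)
  exact (Real.rpow_pos_of_pos (by positivity) _).ne'

/-- The contribution of one frequency cell to the smoothing estimate. -/
theorem eLpNorm_weighted_oscillatoryIntegral_cell_le {s : ℝ} (hs : 0 ≤ s) {f : ℝ → ℝ}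
    (hf : ContDiffOn ℝ 1 f (Ioi 0)) {a : Rn n → ℝ} (ha : ∀ ξ : Rn n, ξ ≠ 0 → a ξ = f ‖ξ‖)
    {Z : Finset ℝ} (hZ : ∀ r, 0 < r → deriv f r = 0 → r ∈ Z)
    (i : Fin n × Bool × Fin (Z.card + 1)) {h g : Rn n → ℂ} (hh : Integrable h) (hg : MemLp g 2)
    (hhg : ∀ᵐ ξ, ‖h ξ‖ₑ ^ 2 ≤ ENNReal.ofReal |deriv f ‖(2 * Real.pi) • ξ‖| * ‖g ξ‖ₑ ^ 2) :
    eLpNorm (fun q : ℝ × Rn n => ((japaneseBracket q.2 ^ (-s) : ℝ) : ℂ) *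
      oscillatoryIntegral (rescaledSymbol a) (frequencyCell f Z i)
        (fun ξ => ((ξ i.1 ^ 2 / ‖ξ‖ ^ 2 : ℝ) : ℂ) * h ξ) q) 2 volume ≤
    (∫⁻ c : ℝ, ENNReal.ofReal ((1 + c ^ 2) ^ (-s))) ^ (1 / 2 : ℝ) * eLpNorm g 2 volume := by
  set p' : Rn n → Rn n →L[ℝ] ℝ := fun ξ =>
    (deriv f ‖(2 * Real.pi) • ξ‖ * ‖ξ‖⁻¹) • innerSL ℝ ξ with hp'
  have hp'e : ∀ ξ, p' ξ (EuclideanSpace.single i.1 1) =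
      deriv f ‖(2 * Real.pi) • ξ‖ * (‖ξ‖⁻¹ * ξ i.1) := by
    intro ξ
    simp [hp', EuclideanSpace.inner_single_right, mul_assoc]
  have hΩ := measurableSet_frequencyCell f Z i
  have hratio : ∀ ξ : Rn n, |ξ i.1| / ‖ξ‖ ≤ 1 := fun ξ =>
    div_le_one_of_le₀ (PiLp.norm_apply_le ξ i.1) (norm_nonneg _)
  have hnorm : ∀ ξ : Rn n, ‖((ξ i.1 ^ 2 / ‖ξ‖ ^ 2 : ℝ) : ℂ)‖ = (|ξ i.1| / ‖ξ‖) ^ 2 := by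
    intro ξ
    rw [Complex.norm_real, Real.norm_of_nonneg (by positivity), div_pow, sq_abs]
  have hle : ∀ᵐ ξ, ‖((ξ i.1 ^ 2 / ‖ξ‖ ^ 2 : ℝ) : ℂ) * h ξ‖ₑ ^ 2 /
      ENNReal.ofReal |p' ξ (EuclideanSpace.single i.1 1)| ≤ ‖g ξ‖ₑ ^ 2 := by
    filter_upwards [hhg] with ξ hξ
    refine ENNReal.div_le_of_le_mul ?_
    set θ := |ξ i.1| / ‖ξ‖ with hθ
    have hθ0 : 0 ≤ θ := by positivity
    have hθ1 : θ ≤ 1 := hratio ξ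
    -- The squared partition weight is θ⁴ while the Jacobian contributes a single θ in the
    -- denominator, so θ ≤ 1 suffices.
    have hθ4 : (θ ^ 2) ^ 2 ≤ θ := by
      rw [← pow_mul]
      exact pow_le_of_le_one hθ0 hθ1 (by norm_num)
    rw [enorm_mul, mul_pow, ← ofReal_norm ((ξ i.1 ^ 2 / ‖ξ‖ ^ 2 : ℝ) : ℂ), hnorm,
      ← ENNReal.ofReal_pow (by positivity), hp'e, abs_mul, abs_mul, abs_inv, abs_norm,
      inv_mul_eq_div, ← hθ, ENNReal.ofReal_mul (abs_nonneg _)]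
    calc ENNReal.ofReal ((θ ^ 2) ^ 2) * ‖h ξ‖ₑ ^ 2
        ≤ ENNReal.ofReal θ * (ENNReal.ofReal |deriv f ‖(2 * Real.pi) • ξ‖| * ‖g ξ‖ₑ ^ 2) := by
          gcongr
      _ = _ := by ring
  have hWle : ∫⁻ ξ in frequencyCell f Z i, ‖((ξ i.1 ^ 2 / ‖ξ‖ ^ 2 : ℝ) : ℂ) * h ξ‖ₑ ^ 2 /
      ENNReal.ofReal |p' ξ (EuclideanSpace.single i.1 1)| ≤ eLpNorm g 2 volume ^ 2 := by
    rw [eLpNorm_two_sq]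
    exact (lintegral_mono_ae (ae_restrict_of_ae hle)).trans (setLIntegral_le_lintegral _ _)
  have hint : Integrable fun ξ => ((ξ i.1 ^ 2 / ‖ξ‖ ^ 2 : ℝ) : ℂ) * h ξ := by
    refine hh.bdd_mul (c := 1) (Measurable.aestronglyMeasurable (by fun_prop))
      (.of_forall fun ξ => ?_)
    rw [hnorm]
    exact pow_le_one₀ (by positivity) (hratio ξ)
  have key := lintegral_weight_mul_oscillatoryIntegral i.1
    (measurable_rescaledSymbol (measurable_radial hf ha)) hΩ (p' := p')
    (fun ξ hξ => hasFDerivAt_rescaledSymbol hf ha (ne_zero_of_mem_frequencyCell hξ))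
    (injOn_replaceCoord_frequencyCell hf ha hZ i)
    (fun ξ hξ => by
      rw [hp'e]
      exact mul_ne_zero hξ.1.2 (mul_ne_zero (inv_ne_zero
        (norm_ne_zero_iff.2 (ne_zero_of_mem_frequencyCell hξ))) hξ.1.1))
    hint.integrableOn (hWle.trans_lt (ENNReal.pow_lt_top hg.2)).ne
    (w := fun c => ENNReal.ofReal ((1 + c ^ 2) ^ (-s))) (by fun_prop)
  have hroot : ((∫⁻ c : ℝ, ENNReal.ofReal ((1 + c ^ 2) ^ (-s))) ^ (1 / 2 : ℝ)) ^ 2 =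
      ∫⁻ c : ℝ, ENNReal.ofReal ((1 + c ^ 2) ^ (-s)) := by
    rw [← ENNReal.rpow_natCast, ← ENNReal.rpow_mul]
    norm_num
  rw [← ENNReal.pow_le_pow_left_iff two_ne_zero, mul_pow, hroot, eLpNorm_two_sq]
  simp only [enorm_mul, mul_pow]
  calc _ ≤ ∫⁻ q : ℝ × Rn n, ENNReal.ofReal ((1 + q.2 i.1 ^ 2) ^ (-s)) *
        ‖oscillatoryIntegral (rescaledSymbol a) (frequencyCell f Z i)
          (fun ξ => ((ξ i.1 ^ 2 / ‖ξ‖ ^ 2 : ℝ) : ℂ) * h ξ) q‖ₑ ^ 2 :=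
        lintegral_mono fun q => mul_le_mul_left
          (enorm_japaneseBracket_rpow_sq_le hs q.2 i.1) _
    _ ≤ _ := by
      rw [key]
      gcongr

/-- The smoothing estimate for wave packets with integrable Fourier transform. -/
theorem exists_eLpNorm_weighted_oscillatoryIntegral_le (hn : 1 ≤ n) {s : ℝ} (hs : 1 / 2 < s)
    {f : ℝ → ℝ} (hf : ContDiffOn ℝ 1 f (Ioi 0))
    (hzeros : {ρ : ℝ | 0 < ρ ∧ deriv f ρ = 0}.Finite)
    {a : Rn n → ℝ} (ha : ∀ ξ : Rn n, ξ ≠ 0 → a ξ = f ‖ξ‖) :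
    ∃ K : NNReal, ∀ h g : Rn n → ℂ, Integrable h → MemLp g 2 →
      (∀ᵐ ξ, h ξ = sqrtGradSymbol a ((2 * Real.pi) • ξ) * g ξ) →
      eLpNorm (fun q : ℝ × Rn n => ((japaneseBracket q.2 ^ (-s) : ℝ) : ℂ) *
        oscillatoryIntegral (rescaledSymbol a) univ h q) 2 volume ≤ K * eLpNorm g 2 volume := by
  set Z := hzeros.toFinset with hZdef
  have hZ : ∀ r, 0 < r → deriv f r = 0 → r ∈ Z := fun r h1 h2 => by simp [hZdef, h1, h2]
  -- Positive dimension makes the origin a null set.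
  have : NeZero n := ⟨by omega⟩
  set I := (∫⁻ c : ℝ, ENNReal.ofReal ((1 + c ^ 2) ^ (-s))) ^ (1 / 2 : ℝ) with hI
  have hItop : I ≠ ⊤ :=
    ENNReal.rpow_ne_top_of_nonneg (by norm_num) (lintegral_one_add_sq_rpow_neg_lt_top hs).ne
  -- The number of cells times the per-cell constant.
  refine ⟨Fintype.card (Fin n × Bool × Fin (Z.card + 1)) * I.toNNReal, fun h g hh hg hhg => ?_⟩
  have hne : ∀ᵐ ξ : Rn n, ξ ≠ 0 := by simp [ae_iff]
  have hsq : ∀ᵐ ξ, ‖h ξ‖ₑ ^ 2 ≤ ENNReal.ofReal |deriv f ‖(2 * Real.pi) • ξ‖| * ‖g ξ‖ₑ ^ 2 := by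
    filter_upwards [hhg, hne] with ξ h1 h2
    rw [h1, enorm_mul, mul_pow, enorm_sqrtGradSymbol_sq hf ha
      (smul_ne_zero (by positivity) h2)]
  have hp : Measurable (rescaledSymbol a) := measurable_rescaledSymbol (measurable_radial hf ha)
  set hi : Fin n × Bool × Fin (Z.card + 1) → Rn n → ℂ := fun i ξ =>
    ((ξ i.1 ^ 2 / ‖ξ‖ ^ 2 : ℝ) : ℂ) * h ξ with hhi
  have hint : ∀ i, Integrable (hi i) := by
    intro i
    refine hh.bdd_mul (c := 1) (Measurable.aestronglyMeasurable (by fun_prop))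
      (.of_forall fun ξ => ?_)
    rw [Complex.norm_real, Real.norm_of_nonneg (by positivity), ← sq_abs (ξ i.1), ← div_pow]
    exact pow_le_one₀ (by positivity)
      (div_le_one_of_le₀ (PiLp.norm_apply_le ξ i.1) (norm_nonneg _))
  have hosc : ∀ q, oscillatoryIntegral (rescaledSymbol a) univ h q =
      ∑ i, oscillatoryIntegral (rescaledSymbol a) (frequencyCell f Z i) (hi i) q := by
    intro q
    simp only [oscillatoryIntegral, setIntegral_univ]
    simp_rw [← fun i => integral_indicator (μ := volume) (measurableSet_frequencyCell f Z i)
      (f := fun ξ => Real.fourierChar (inner ℝ ξ q.2 + q.1 * rescaledSymbol a ξ) • hi i ξ)]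
    rw [← integral_finsetSum _ fun i _ =>
      (integrable_fourierChar_smul (by fun_prop) (hint i)).indicator (measurableSet_frequencyCell f Z i)]
    refine integral_congr_ae ?_
    filter_upwards [hsq, hne] with ξ h1 h2
    -- Frequencies with f' = 0 lie in no cell, but there h vanishes together with |∇a|^{1/2}.
    by_cases hd : deriv f ‖(2 * Real.pi) • ξ‖ = 0
    · have h0 : h ξ = 0 := by simpa [hd] using h1
      rw [h0, smul_zero, Finset.sum_eq_zero]
      intro i _
      by_cases hm : ξ ∈ frequencyCell f Z i <;> simp [hm, hhi, h0]
    · have hsum := sum_indicator_frequencyCell (Z := Z) h2 hd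
        (Real.fourierChar (inner ℝ ξ q.2 + q.1 * rescaledSymbol a ξ) • h ξ)
      refine hsum.symm.trans (Finset.sum_congr rfl fun i _ => ?_)
      by_cases hm : ξ ∈ frequencyCell f Z i <;>
        simp only [hm, indicator_of_mem, indicator_of_notMem, not_false_eq_true, hhi, mul_smul_comm]
  have hcont : ∀ i, AEStronglyMeasurable (fun q : ℝ × Rn n =>
      ((japaneseBracket q.2 ^ (-s) : ℝ) : ℂ) *
      oscillatoryIntegral (rescaledSymbol a) (frequencyCell f Z i) (hi i) q) volume := fun i =>
    (((continuous_japaneseBracket_rpow (-s)).comp continuous_snd).mul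
      (continuous_oscillatoryIntegral hp (hint i).integrableOn)).aestronglyMeasurable
  have hfun : (fun q : ℝ × Rn n => ((japaneseBracket q.2 ^ (-s) : ℝ) : ℂ) *
      oscillatoryIntegral (rescaledSymbol a) univ h q) = ∑ i, fun q : ℝ × Rn n =>
      ((japaneseBracket q.2 ^ (-s) : ℝ) : ℂ) *
      oscillatoryIntegral (rescaledSymbol a) (frequencyCell f Z i) (hi i) q := by
    ext q
    rw [hosc, Finset.mul_sum, Finset.sum_apply]
  rw [hfun]
  refine (eLpNorm_sum_le (fun i _ => hcont i) (by norm_num)).trans ?_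
  refine (Finset.sum_le_sum fun i _ => eLpNorm_weighted_oscillatoryIntegral_cell_le
    (by linarith) hf ha hZ i hh hg hsq).trans ?_
  rw [Finset.sum_const, Finset.card_univ, nsmul_eq_mul, ← hI, ENNReal.coe_mul,
    ENNReal.coe_toNNReal hItop, ENNReal.coe_natCast, mul_assoc]

end SmoothingEstimate

/-! ### Frequency cutoffs and density of the domains. -/

section FrequencyCutoff

variable {n : ℕ}

theorem eq_of_fourier_ae_eq {φ ψ : L2x n}
    (h : ((𝓕 φ : L2x n) : Rn n → ℂ) =ᵐ[volume] (𝓕 ψ : L2x n)) : φ = ψ :=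
  (Lp.fourierTransformₗᵢ (Rn n) ℂ).injective (Lp.ext h)

theorem fourier_fourierMultiplier {m : Rn n → ℂ} {φ : L2x n} (hφ : φ ∈ multiplierDomain m) :
    ((𝓕 (fourierMultiplier m φ) : L2x n) : Rn n → ℂ) =ᵐ[volume] multipliedFourier m φ := by
  have hφ' : MemLp (multipliedFourier m φ) 2 volume := hφ
  rw [fourierMultiplier, dif_pos hφ', FourierTransform.fourier_fourierInv_eq]
  exact hφ'.coeFn_toLp

/-- The restriction of a function to the frequencies in `A`. -/
noncomputable def frequencyCutoff {A : Set (Rn n)} (hA : MeasurableSet A) (φ : L2x n) : L2x n :=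
  𝓕⁻ (((Lp.memLp (𝓕 φ : L2x n)).indicator hA).toLp _)

theorem fourier_frequencyCutoff {A : Set (Rn n)} (hA : MeasurableSet A) (φ : L2x n) :
    ((𝓕 (frequencyCutoff hA φ) : L2x n) : Rn n → ℂ) =ᵐ[volume] A.indicator (𝓕 φ : L2x n) := by
  rw [frequencyCutoff, FourierTransform.fourier_fourierInv_eq]
  exact MemLp.coeFn_toLp _

/-- Dominated convergence for the squares: each point eventually lies in `A k`, where the difference
vanishes. -/
theorem tendsto_eLpNorm_indicator_sub {α : Type*} [MeasurableSpace α] {μ : Measure α} {v : α → ℂ}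
    (hv : MemLp v 2 μ) {A : ℕ → Set α} (hA : ∀ k, MeasurableSet (A k)) (hmono : Monotone A)
    (hU : ⋃ k, A k = univ) :
    Tendsto (fun k => eLpNorm ((A k).indicator v - v) 2 μ) atTop (𝓝 0) := by
  have hle : ∀ k x, ‖((A k).indicator v - v) x‖ₑ ≤ ‖v x‖ₑ := by
    intro k x
    by_cases hx : x ∈ A k <;> simp [hx]
  have h2 : Tendsto (fun k => ∫⁻ x, ‖((A k).indicator v - v) x‖ₑ ^ 2 ∂μ) atTop
      (𝓝 (∫⁻ _, 0 ∂μ)) := by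
    refine tendsto_lintegral_of_dominated_convergence' (fun x => ‖v x‖ₑ ^ 2) (fun k => ?_)
      (fun k => .of_forall fun x => ?_) ?_ (.of_forall fun x => ?_)
    · exact (((hv.1.indicator (hA k)).sub hv.1).enorm).pow_const 2
    · exact pow_le_pow_left' (hle k x) 2
    · rw [← eLpNorm_two_sq]
      exact (ENNReal.pow_lt_top hv.2).ne
    · obtain ⟨k, hk⟩ := mem_iUnion.1 (hU ▸ mem_univ x : x ∈ ⋃ k, A k)
      refine tendsto_const_nhds.congr' ?_
      filter_upwards [eventually_ge_atTop k] with l hl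
      simp [hmono hl hk]
  simp only [← eLpNorm_two_sq, lintegral_zero] at h2
  have h3 := (ENNReal.continuous_rpow_const (y := (1 / 2 : ℝ))).tendsto 0 |>.comp h2
  rw [ENNReal.zero_rpow_of_pos (by norm_num)] at h3
  refine h3.congr fun k => ?_
  rw [Function.comp_apply, ← ENNReal.rpow_natCast, ← ENNReal.rpow_mul]
  norm_num

theorem tendsto_frequencyCutoff {A : ℕ → Set (Rn n)} (hA : ∀ k, MeasurableSet (A k))
    (hmono : Monotone A) (hU : ⋃ k, A k = univ) (φ : L2x n) :
    Tendsto (fun k => frequencyCutoff (hA k) φ) atTop (𝓝 φ) := by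
  have h1 : Tendsto (fun k => ((Lp.memLp (𝓕 φ : L2x n)).indicator (hA k)).toLp _) atTop
      (𝓝 (𝓕 φ : L2x n)) := by
    have h := (Lp.tendsto_Lp_iff_tendsto_eLpNorm'' (fun k => (A k).indicator (𝓕 φ : L2x n))
      (fun k => (Lp.memLp (𝓕 φ : L2x n)).indicator (hA k)) (𝓕 φ : L2x n)
      (Lp.memLp (𝓕 φ : L2x n))).2
      (tendsto_eLpNorm_indicator_sub (Lp.memLp (𝓕 φ : L2x n)) hA hmono hU)
    rwa [Lp.toLp_coeFn] at h
  have h2 := ((Lp.fourierTransformₗᵢ (Rn n) ℂ).symm.continuous.tendsto (𝓕 φ : L2x n)).comp h1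
  have e : (Lp.fourierTransformₗᵢ (Rn n) ℂ).symm (𝓕 φ : L2x n) = φ :=
    (Lp.fourierTransformₗᵢ (Rn n) ℂ).symm_apply_apply φ
  rw [e] at h2
  exact h2

/-- Bounded frequencies at which the symbol `m` is bounded. -/
def sublevelFrequencies (m : Rn n → ℂ) (k : ℕ) : Set (Rn n) :=
  {ξ | ‖ξ‖ ≤ k ∧ ‖m ((2 * Real.pi) • ξ)‖ ≤ k}

theorem measurableSet_sublevelFrequencies {m : Rn n → ℂ} (hm : Measurable m) (k : ℕ) :
    MeasurableSet (sublevelFrequencies m k) :=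
  (measurableSet_le measurable_norm measurable_const).inter
    (measurableSet_le (hm.comp (measurable_const_smul _)).norm measurable_const)

theorem monotone_sublevelFrequencies (m : Rn n → ℂ) : Monotone (sublevelFrequencies m) := by
  intro k l hkl ξ hξ
  have : (k : ℝ) ≤ l := by exact_mod_cast hkl
  exact ⟨hξ.1.trans this, hξ.2.trans this⟩

theorem iUnion_sublevelFrequencies (m : Rn n → ℂ) : ⋃ k, sublevelFrequencies m k = univ := by
  refine eq_univ_of_forall fun ξ => mem_iUnion.2 ?_
  obtain ⟨k, hk⟩ := exists_nat_ge (max ‖ξ‖ ‖m ((2 * Real.pi) • ξ)‖)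
  exact ⟨k, (le_max_left _ _).trans hk, (le_max_right _ _).trans hk⟩

theorem multipliedFourier_frequencyCutoff (m : Rn n → ℂ) {A : Set (Rn n)} (hA : MeasurableSet A)
    (φ : L2x n) :
    multipliedFourier m (frequencyCutoff hA φ) =ᵐ[volume] A.indicator (multipliedFourier m φ) := by
  filter_upwards [fourier_frequencyCutoff hA φ] with ξ hξ
  by_cases h : ξ ∈ A <;> simp [multipliedFourier, hξ, h]

theorem memLp_multipliedFourier_frequencyCutoff {m : Rn n → ℂ} (hm : Measurable m) (k : ℕ)
    (φ : L2x n) :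
    MemLp (multipliedFourier m
      (frequencyCutoff (measurableSet_sublevelFrequencies hm k) φ)) 2 volume := by
  refine ((Lp.memLp (𝓕 φ : L2x n)).const_mul (k : ℂ)).mono ?_ ?_
  · exact ((hm.comp (measurable_const_smul _)).aestronglyMeasurable).mul
      (Lp.aestronglyMeasurable _)
  · filter_upwards [multipliedFourier_frequencyCutoff m
      (measurableSet_sublevelFrequencies hm k) φ] with ξ hξ
    rw [hξ]
    by_cases h : ξ ∈ sublevelFrequencies m k
    · rw [indicator_of_mem h, multipliedFourier, norm_mul, norm_mul, Complex.norm_natCast]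
      exact mul_le_mul_of_nonneg_right h.2 (norm_nonneg _)
    · rw [indicator_of_notMem h, norm_zero]
      positivity

/-- The cutoff confines frequencies to a bounded set, of finite measure, on which L² is contained in
L¹. -/
theorem integrable_multipliedFourier_frequencyCutoff {m : Rn n → ℂ} (hm : Measurable m) (k : ℕ)
    (φ : L2x n) :
    Integrable (multipliedFourier m
      (frequencyCutoff (measurableSet_sublevelFrequencies hm k) φ)) := by
  have hA := measurableSet_sublevelFrequencies hm k
  have hfin : volume (sublevelFrequencies m k) < ⊤ :=
    (measure_mono fun ξ hξ => mem_closedBall_zero_iff.2 hξ.1).trans_lt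
      (measure_closedBall_lt_top (x := (0 : Rn n)) (r := k))
  have : IsFiniteMeasure (volume.restrict (sublevelFrequencies m k)) := ⟨by simpa using hfin⟩
  have hae := multipliedFourier_frequencyCutoff m hA φ
  have h1 : IntegrableOn (multipliedFourier m (frequencyCutoff hA φ)) (sublevelFrequencies m k) :=
    ((memLp_multipliedFourier_frequencyCutoff hm k φ).restrict _).integrable (by norm_num)
  refine ((integrable_indicator_iff hA).2 h1).congr ?_
  filter_upwards [hae] with ξ hξ
  by_cases h : ξ ∈ sublevelFrequencies m k
  · simp [h]
  · simp [h, hξ]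

theorem dense_multiplierDomain {m : Rn n → ℂ} (hm : Measurable m) : Dense (multiplierDomain m) :=
  fun φ => mem_closure_of_tendsto
    (tendsto_frequencyCutoff (measurableSet_sublevelFrequencies hm)
      (monotone_sublevelFrequencies m) (iUnion_sublevelFrequencies m) φ)
    (.of_forall fun k => memLp_multipliedFourier_frequencyCutoff hm k φ)

end FrequencyCutoff

/-! ### The evolution on the Fourier side and as an oscillatory integral. -/

section Evolution

variable {n : ℕ} {a : Rn n → ℝ}

theorem exp_mul_symbol_eq_fourierChar (a : Rn n → ℝ) (t : ℝ) (ξ : Rn n) :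
    Complex.exp (Complex.I * (t : ℂ) * (a ((2 * Real.pi) • ξ) : ℂ)) =
      (Real.fourierChar (t * rescaledSymbol a ξ) : ℂ) := by
  have hpi : (Real.pi : ℂ) ≠ 0 := by exact_mod_cast Real.pi_ne_zero
  rw [Real.fourierChar_apply, rescaledSymbol]
  congr 1
  push_cast
  field_simp

theorem fourier_propagator (ha : Measurable a) (t : ℝ) (φ : L2x n) :
    ((𝓕 (propagator a t φ) : L2x n) : Rn n → ℂ) =ᵐ[volume]
      fun ξ => Real.fourierChar (t * rescaledSymbol a ξ) • (𝓕 φ : L2x n) ξ := by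
  have e : multipliedFourier (fun ξ => Complex.exp (Complex.I * (t : ℂ) * (a ξ : ℂ))) φ =
      fun ξ => Real.fourierChar (t * rescaledSymbol a ξ) • (𝓕 φ : L2x n) ξ := by
    ext ξ
    rw [multipliedFourier, exp_mul_symbol_eq_fourierChar, Circle.smul_def, smul_eq_mul]
  have hmem : φ ∈ multiplierDomain
      (fun ξ => Complex.exp (Complex.I * (t : ℂ) * (a ξ : ℂ))) := by
    change MemLp _ 2 volume
    rw [e]
    refine (Lp.memLp (𝓕 φ : L2x n)).mono (AEStronglyMeasurable.smul
      (f := fun ξ => Real.fourierChar (t * rescaledSymbol a ξ)) ?_ (Lp.aestronglyMeasurable _))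
      (.of_forall fun ξ => by simp)
    have hp := measurable_rescaledSymbol ha
    exact Real.continuous_fourierChar.comp_aestronglyMeasurable
      (Measurable.aestronglyMeasurable (by fun_prop))
  exact (fourier_fourierMultiplier hmem).trans (.of_forall fun ξ => congrFun e ξ)

/-- The Fourier transform of `m(D_x) e^{i t a(D_x)} φ`. -/
noncomputable def evolvedFourier (m : Rn n → ℂ) (a : Rn n → ℝ) (t : ℝ) (φ : L2x n) : Rn n → ℂ :=
  fun ξ => Real.fourierChar (t * rescaledSymbol a ξ) • multipliedFourier m φ ξ

theorem multipliedFourier_propagator (m : Rn n → ℂ) (ha : Measurable a) (t : ℝ) (φ : L2x n) :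
    multipliedFourier m (propagator a t φ) =ᵐ[volume] evolvedFourier m a t φ := by
  filter_upwards [fourier_propagator ha t φ] with ξ hξ
  rw [multipliedFourier, hξ, evolvedFourier, multipliedFourier, mul_smul_comm]

theorem aestronglyMeasurable_evolvedFourier {m : Rn n → ℂ} (ha : Measurable a) (t : ℝ) {φ : L2x n}
    (hφ : AEStronglyMeasurable (multipliedFourier m φ) volume) :
    AEStronglyMeasurable (evolvedFourier m a t φ) volume := by
  have hp := measurable_rescaledSymbol ha
  exact AEStronglyMeasurable.smul (f := fun ξ => Real.fourierChar (t * rescaledSymbol a ξ))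
    (Real.continuous_fourierChar.comp_aestronglyMeasurable
      (Measurable.aestronglyMeasurable (by fun_prop))) hφ

theorem memLp_evolvedFourier {m : Rn n → ℂ} (ha : Measurable a) (t : ℝ) {φ : L2x n}
    (hφ : φ ∈ multiplierDomain m) : MemLp (evolvedFourier m a t φ) 2 volume :=
  MemLp.mono hφ (aestronglyMeasurable_evolvedFourier ha t (MemLp.aestronglyMeasurable hφ))
    (.of_forall fun ξ => by simp [evolvedFourier])

theorem integrable_evolvedFourier {m : Rn n → ℂ} (ha : Measurable a) (t : ℝ) {φ : L2x n}
    (hφ : Integrable (multipliedFourier m φ)) : Integrable (evolvedFourier m a t φ) :=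
  hφ.mono (aestronglyMeasurable_evolvedFourier ha t hφ.aestronglyMeasurable)
    (.of_forall fun ξ => by simp [evolvedFourier])

theorem fourier_fourierMultiplier_propagator {m : Rn n → ℂ} (ha : Measurable a) (t : ℝ)
    {φ : L2x n} (hφ : φ ∈ multiplierDomain m) :
    ((𝓕 (fourierMultiplier m (propagator a t φ)) : L2x n) : Rn n → ℂ) =ᵐ[volume]
      evolvedFourier m a t φ :=
  have h := multipliedFourier_propagator m ha t φ
  have hmem : propagator a t φ ∈ multiplierDomain m :=
    (memLp_congr_ae h).2 (memLp_evolvedFourier ha t hφ)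
  (fourier_fourierMultiplier hmem).trans h

/-- All three operators are multiplications on the Fourier side. For fixed t this turns convergence
of the cutoffs into convergence of the evolved approximants. -/
theorem fourierMultiplier_propagator_frequencyCutoff {m : Rn n → ℂ} (hm : Measurable m)
    (ha : Measurable a) (t : ℝ) (k : ℕ) {φ : L2x n} (hφ : φ ∈ multiplierDomain m) :
    fourierMultiplier m (propagator a t
      (frequencyCutoff (measurableSet_sublevelFrequencies hm k) φ)) =
    frequencyCutoff (measurableSet_sublevelFrequencies hm k)
      (fourierMultiplier m (propagator a t φ)) := by
  have hA := measurableSet_sublevelFrequencies hm k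
  refine eq_of_fourier_ae_eq ?_
  filter_upwards [fourier_fourierMultiplier_propagator ha t
      (memLp_multipliedFourier_frequencyCutoff hm k φ),
    fourier_frequencyCutoff hA (fourierMultiplier m (propagator a t φ)),
    fourier_fourierMultiplier_propagator ha t hφ,
    multipliedFourier_frequencyCutoff m hA φ] with ξ h1 h2 h3 h4
  rw [h1, h2, evolvedFourier, h4]
  by_cases h : ξ ∈ sublevelFrequencies m k
  · rw [indicator_of_mem h, indicator_of_mem h, h3, evolvedFourier]
  · rw [indicator_of_notMem h, indicator_of_notMem h, smul_zero]

/-- On integrable frequency profiles the evolution is given by an oscillatory integral. -/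
theorem fourierMultiplier_propagator_ae_eq {m : Rn n → ℂ} (ha : Measurable a) (t : ℝ) {φ : L2x n}
    (hφ : φ ∈ multiplierDomain m) (hint : Integrable (multipliedFourier m φ)) :
    (fourierMultiplier m (propagator a t φ) : Rn n → ℂ) =ᵐ[volume]
      fun x => oscillatoryIntegral (rescaledSymbol a) univ (multipliedFourier m φ) (t, x) := by
  have h2 := memLp_evolvedFourier ha t hφ
  have e : fourierMultiplier m (propagator a t φ) = 𝓕⁻ (h2.toLp (evolvedFourier m a t φ)) := by
    refine eq_of_fourier_ae_eq ?_
    rw [FourierTransform.fourier_fourierInv_eq]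
    exact (fourier_fourierMultiplier_propagator ha t hφ).trans h2.coeFn_toLp.symm
  rw [e]
  refine (fourierInv_toLp_ae_eq (integrable_evolvedFourier ha t hint) h2).trans
    (.of_forall fun x => ?_)
  simp only [Real.fourierInv_eq, oscillatoryIntegral, setIntegral_univ, evolvedFourier]
  congr 1
  ext ξ
  rw [AddChar.map_add_eq_mul, mul_smul]

end Evolution

/-! ### The operator on a dense core and its extension. -/

section SmoothingOperator

variable {n : ℕ} {a : Rn n → ℝ}

theorem multipliedFourier_add (m : Rn n → ℂ) (φ ψ : L2x n) :
    multipliedFourier m (φ + ψ) =ᵐ[volume] multipliedFourier m φ + multipliedFourier m ψ := by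
  have h : (𝓕 (φ + ψ) : L2x n) = 𝓕 φ + 𝓕 ψ := FourierTransform.fourier_add φ ψ
  filter_upwards [Lp.coeFn_add (𝓕 φ : L2x n) (𝓕 ψ)] with ξ hξ
  rw [multipliedFourier, h, hξ, Pi.add_apply, Pi.add_apply, mul_add]
  rfl

theorem multipliedFourier_smul (m : Rn n → ℂ) (c : ℂ) (φ : L2x n) :
    multipliedFourier m (c • φ) =ᵐ[volume] c • multipliedFourier m φ := by
  have h : (𝓕 (c • φ) : L2x n) = c • 𝓕 φ := FourierTransform.fourier_smul c φ
  filter_upwards [Lp.coeFn_smul c (𝓕 φ : L2x n)] with ξ hξ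
  rw [multipliedFourier, h, hξ, Pi.smul_apply, Pi.smul_apply, mul_smul_comm]
  rfl

/-- The `φ` for which the Fourier transform of `m(D_x) φ` is in `L¹ ∩ L²`. -/
def integrableDomain (m : Rn n → ℂ) : Submodule ℂ (L2x n) where
  carrier := {φ | φ ∈ multiplierDomain m ∧ Integrable (multipliedFourier m φ)}
  add_mem' {φ ψ} hφ hψ :=
    ⟨(memLp_congr_ae (multipliedFourier_add m φ ψ)).2 (MemLp.add hφ.1 hψ.1),
      (hφ.2.add hψ.2).congr (multipliedFourier_add m φ ψ).symm⟩
  zero_mem' := by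
    have h : multipliedFourier m (0 : L2x n) =ᵐ[volume] 0 := by
      simpa using multipliedFourier_smul m 0 (0 : L2x n)
    exact ⟨(memLp_congr_ae h).2 MemLp.zero, (integrable_zero _ _ _).congr h.symm⟩
  smul_mem' c φ hφ :=
    ⟨(memLp_congr_ae (multipliedFourier_smul m c φ)).2 (MemLp.const_smul hφ.1 c),
      (hφ.2.smul c).congr (multipliedFourier_smul m c φ).symm⟩

theorem frequencyCutoff_mem_integrableDomain {m : Rn n → ℂ} (hm : Measurable m) (k : ℕ)
    (φ : L2x n) :
    frequencyCutoff (measurableSet_sublevelFrequencies hm k) φ ∈ integrableDomain m :=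
  ⟨memLp_multipliedFourier_frequencyCutoff hm k φ,
    integrable_multipliedFourier_frequencyCutoff hm k φ⟩

theorem denseRange_integrableDomain_subtype {m : Rn n → ℂ} (hm : Measurable m) :
    DenseRange (integrableDomain m).subtype := by
  refine fun φ => mem_closure_of_tendsto
    (tendsto_frequencyCutoff (measurableSet_sublevelFrequencies hm)
      (monotone_sublevelFrequencies m) (iUnion_sublevelFrequencies m) φ)
    (.of_forall fun k => ?_)
  exact ⟨⟨_, frequencyCutoff_mem_integrableDomain hm k φ⟩, rfl⟩

/-- The function `⟨x⟩^{-s} m(D_x) e^{i t a(D_x)} φ` of `(t, x)`. -/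
noncomputable def weightedEvolution (s : ℝ) (m : Rn n → ℂ) (a : Rn n → ℝ) (φ : L2x n)
    (q : ℝ × Rn n) : ℂ :=
  ((japaneseBracket q.2 ^ (-s) : ℝ) : ℂ) *
    oscillatoryIntegral (rescaledSymbol a) univ (multipliedFourier m φ) q

theorem oscillatoryIntegral_congr_ae (p : Rn n → ℝ) {g h : Rn n → ℂ} (hgh : g =ᵐ[volume] h)
    (q : ℝ × Rn n) : oscillatoryIntegral p univ g q = oscillatoryIntegral p univ h q := by
  simp only [oscillatoryIntegral, setIntegral_univ]
  refine integral_congr_ae ?_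
  filter_upwards [hgh] with ξ hξ
  rw [hξ]

theorem oscillatoryIntegral_add {p : Rn n → ℝ} (hp : Measurable p) {g h : Rn n → ℂ}
    (hg : Integrable g) (hh : Integrable h) (q : ℝ × Rn n) :
    oscillatoryIntegral p univ (g + h) q =
      oscillatoryIntegral p univ g q + oscillatoryIntegral p univ h q := by
  simp only [oscillatoryIntegral, setIntegral_univ, Pi.add_apply, smul_add]
  exact integral_add (integrable_fourierChar_smul (by fun_prop) hg)
    (integrable_fourierChar_smul (by fun_prop) hh)

theorem oscillatoryIntegral_smul (p : Rn n → ℝ) (c : ℂ) (h : Rn n → ℂ) (q : ℝ × Rn n) :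
    oscillatoryIntegral p univ (c • h) q = c * oscillatoryIntegral p univ h q := by
  rw [oscillatoryIntegral, oscillatoryIntegral, ← integral_const_mul]
  refine integral_congr_ae (.of_forall fun ξ => ?_)
  simp only [Pi.smul_apply, smul_eq_mul, mul_smul_comm]

theorem weightedEvolution_add (s : ℝ) {m : Rn n → ℂ} (ha : Measurable a) {φ ψ : L2x n}
    (hφ : φ ∈ integrableDomain m) (hψ : ψ ∈ integrableDomain m) :
    weightedEvolution s m a (φ + ψ) = weightedEvolution s m a φ + weightedEvolution s m a ψ := by
  ext q
  rw [weightedEvolution, oscillatoryIntegral_congr_ae _ (multipliedFourier_add m φ ψ),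
    oscillatoryIntegral_add (measurable_rescaledSymbol ha) hφ.2 hψ.2, mul_add]
  rfl

theorem weightedEvolution_smul (s : ℝ) (m : Rn n → ℂ) (c : ℂ) (φ : L2x n) :
    weightedEvolution s m a (c • φ) = c • weightedEvolution s m a φ := by
  ext q
  rw [weightedEvolution, oscillatoryIntegral_congr_ae _ (multipliedFourier_smul m c φ),
    oscillatoryIntegral_smul, mul_left_comm]
  rfl

/-- The operator `φ ↦ ⟨x⟩^{-s} m(D_x) e^{i t a(D_x)} φ` on `integrableDomain m`. -/
noncomputable def smoothingMap (s : ℝ) {m : Rn n → ℂ} (ha : Measurable a)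
    (h : ∀ φ ∈ integrableDomain m, MemLp (weightedEvolution s m a φ) 2 volume) :
    integrableDomain m →ₗ[ℂ] L2tx n where
  toFun φ := (h φ φ.2).toLp _
  map_add' φ ψ := by
    rw [← MemLp.toLp_add, MemLp.toLp_eq_toLp_iff, Submodule.coe_add,
      weightedEvolution_add s ha φ.2 ψ.2]
  map_smul' c φ := by
    rw [RingHom.id_apply, ← MemLp.toLp_const_smul, MemLp.toLp_eq_toLp_iff, Submodule.coe_smul,
      weightedEvolution_smul]

theorem eLpNorm_fourier (φ : L2x n) : eLpNorm (𝓕 φ : L2x n) 2 volume = ENNReal.ofReal ‖φ‖ := by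
  rw [← Lp.enorm_def, ← ofReal_norm, Lp.norm_fourier_eq]

/-- If a sequence converges in `L²(ℝ × ℝⁿ)` and its time slices converge in `L²(ℝⁿ)`, then the
limits agree. -/
theorem ae_slice_eq_of_tendsto {T : ℕ → L2tx n} {T₀ : L2tx n} (hT : Tendsto T atTop (𝓝 T₀))
    {W : ℕ → ℝ → L2x n} {W₀ : ℝ → L2x n} (hW : ∀ t, Tendsto (fun k => W k t) atTop (𝓝 (W₀ t)))
    {w : Rn n → ℂ} (h : ∀ k, ∀ᵐ t, ∀ᵐ x, T k (t, x) = w x * W k t x) :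
    ∀ᵐ t, ∀ᵐ x, T₀ (t, x) = w x * W₀ t x := by
  -- One subsequence converges almost everywhere on the product. For each good t a further
  -- subsequence, depending on t, makes the slices converge almost everywhere in x.
  obtain ⟨u, hu, hlim⟩ := (tendstoInMeasure_of_tendsto_Lp hT).exists_seq_tendsto_ae
  filter_upwards [Measure.ae_ae_of_ae_prod hlim, ae_all_iff.2 h] with t h1 h2
  obtain ⟨v, hv, hlim'⟩ := (tendstoInMeasure_of_tendsto_Lp
    ((hW t).comp hu.tendsto_atTop)).exists_seq_tendsto_ae
  filter_upwards [h1, hlim', ae_all_iff.2 h2] with x h3 h4 h5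
  refine tendsto_nhds_unique (h3.comp hv.tendsto_atTop) ((h4.const_mul (w x)).congr fun k => ?_)
  simp only [Function.comp_apply, h5]

end SmoothingOperator

/-- Invariant smoothing estimate for radial symbols. `T` is the operator
`φ ↦ ⟨x⟩^{-s} |∇a(D_x)|^{1/2} e^{i t a(D_x)} φ`: it has this meaning literally on the natural dense
domain of `|∇a(D_x)|^{1/2}`, and is its (unique) bounded extension on the rest of `L²(ℝⁿ)`. -/
theorem theorem3p1 (n : ℕ) (hn : 1 ≤ n) (s : ℝ) (hs : 1 / 2 < s)
    (f : ℝ → ℝ) (hf : ContDiffOn ℝ 1 f (Ioi 0))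
    (hzeros : {ρ : ℝ | 0 < ρ ∧ deriv f ρ = 0}.Finite)
    (a : Rn n → ℝ) (ha : ∀ ξ : Rn n, ξ ≠ 0 → a ξ = f ‖ξ‖) :
    Dense (multiplierDomain (sqrtGradSymbol a)) ∧
    ∃ C : ℝ, 0 < C ∧ ∃ T : L2x n →L[ℂ] L2tx n,
      (∀ φ ∈ multiplierDomain (sqrtGradSymbol a), ∀ᵐ t : ℝ, ∀ᵐ x : Rn n,
        T φ (t, x) = ((japaneseBracket x ^ (-s) : ℝ) : ℂ) *
          fourierMultiplier (sqrtGradSymbol a) (propagator a t φ) x) ∧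
      ∀ φ : L2x n, ‖T φ‖ ≤ C * ‖φ‖ := by
  have hm := measurable_sqrtGradSymbol a
  have ham := measurable_radial hf ha
  refine ⟨dense_multiplierDomain hm, ?_⟩
  set m := sqrtGradSymbol a with hmdef
  obtain ⟨K, hK⟩ := exists_eLpNorm_weighted_oscillatoryIntegral_le hn hs hf hzeros ha
  have hbound : ∀ φ ∈ integrableDomain m,
      eLpNorm (weightedEvolution s m a φ) 2 volume ≤ ENNReal.ofReal (K * ‖φ‖) := by
    intro φ hφ
    rw [ENNReal.ofReal_mul K.coe_nonneg, ENNReal.ofReal_coe_nnreal, ← eLpNorm_fourier]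
    exact hK _ _ hφ.2 (Lp.memLp (𝓕 φ : L2x n)) (.of_forall fun ξ => rfl)
  have hL2 : ∀ φ ∈ integrableDomain m, MemLp (weightedEvolution s m a φ) 2 volume := by
    refine fun φ hφ => ⟨?_, (hbound φ hφ).trans_lt ENNReal.ofReal_lt_top⟩
    exact (((continuous_japaneseBracket_rpow (-s)).comp continuous_snd).mul
      (continuous_oscillatoryIntegral (measurable_rescaledSymbol ham)
        hφ.2.integrableOn)).aestronglyMeasurable
  have hdense := denseRange_integrableDomain_subtype hm
  -- The added 1 keeps the final constant positive even if K = 0.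
  have hnorm : ∀ φ : integrableDomain m,
      ‖smoothingMap s ham hL2 φ‖ ≤ (K + 1) * ‖(integrableDomain m).subtype φ‖ := by
    intro φ
    have h1 : ‖smoothingMap s ham hL2 φ‖ ≤ K * ‖(φ : L2x n)‖ := by
      refine (Lp.norm_toLp _ (hL2 φ φ.2)).trans_le ?_
      exact ENNReal.toReal_le_of_le_ofReal (by positivity) (hbound φ φ.2)
    refine h1.trans (mul_le_mul_of_nonneg_right ?_ (norm_nonneg _))
    linarith
  set T : L2x n →L[ℂ] L2tx n := (smoothingMap s ham hL2).extendOfNorm (integrableDomain m).subtype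
    with hT
  refine ⟨K + 1, by positivity, T, fun φ hφ => ?_,
    LinearMap.norm_extendOfNorm_apply_le hdense _ hnorm⟩
  have hcore : ∀ ψ ∈ integrableDomain m, ∀ᵐ t : ℝ, ∀ᵐ x : Rn n,
      T ψ (t, x) = ((japaneseBracket x ^ (-s) : ℝ) : ℂ) *
        fourierMultiplier m (propagator a t ψ) x := by
    intro ψ hψ
    have h1 : T ψ = (hL2 ψ hψ).toLp _ :=
      LinearMap.extendOfNorm_eq hdense ⟨_, hnorm⟩ (⟨ψ, hψ⟩ : integrableDomain m)
    have h2 : ∀ᵐ q : ℝ × Rn n, T ψ q = weightedEvolution s m a ψ q := by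
      rw [h1]
      exact (hL2 ψ hψ).coeFn_toLp
    filter_upwards [Measure.ae_ae_of_ae_prod h2] with t ht
    filter_upwards [ht, fourierMultiplier_propagator_ae_eq ham t hψ.1 hψ.2] with x h3 h4
    rw [h3, h4, weightedEvolution]
  have hA := measurableSet_sublevelFrequencies hm
  have hlim := tendsto_frequencyCutoff hA (monotone_sublevelFrequencies m)
    (iUnion_sublevelFrequencies m)
  -- The cutoffs of φ lie in the core. Their images under T converge by continuity, and their time
  -- slices converge because the cutoff commutes with the evolution.
  refine ae_slice_eq_of_tendsto ((T.continuous.tendsto φ).comp (hlim φ))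
    (W := fun k t => fourierMultiplier m (propagator a t (frequencyCutoff (hA k) φ)))
    (fun t => ?_) fun k => hcore _ (frequencyCutoff_mem_integrableDomain hm k φ)
  exact (hlim _).congr fun k =>
    (fourierMultiplier_propagator_frequencyCutoff hm ham t k hφ).symm
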